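/- Let $m\ge 2$ and let $P_{2m}$ be a centrally symmetric convex $2m$-gon in the Euclidean plane $\mathbb{E}^2$. For a positive integer $k$ and a discrete multiset $X$ of points of $\mathbb{E}^2$ (every bounded set contains only finitely many members of $X$, counted with multiplicity), call $P_{2m}+X$ a $k$-fold translative tiling of $\mathbb{E}^2$ if, counting with multiplicity, every point of $\mathbb{E}^2$ belongs to at least $k$ of the translates $P_{2m}+\mathbf{x}$, $\mathbf{x}\in X$, and to at most $k$ of the translates $\mathrm{int}(P_{2m})+\mathbf{x}$, $\mathbf{x}\in X$. Let $\tau(P_{2m})$ be the smallest positive integer $k$ for which there is a multiset $X$ such that $P_{2m}+X$ is a $k$-fold translative tiling of $\mathbb{E}^2$, and $\tau(P_{2m})=\infty$ if there is no such $k$. Then $$\tau(P_{2m})\ge\begin{cases} m-1, & \text{if } m \text{ is even},\\ m-2, & \text{if } m \text{ is odd}.\end{cases}$$ -/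

import Mathlib

namespace MultipleTiling

open scoped Pointwise

/-- The Euclidean plane. -/
abbrev Plane : Type := EuclideanSpace ℝ (Fin 2)

/-- The oriented area of the parallelogram spanned by `a` and `b`. -/
def cross (a b : Plane) : ℝ := a 0 * b 1 - a 1 * b 0

/-- `P` is a convex `n`-gon: the convex hull of `n ≥ 3` points `v i`, enumerated cyclically (in
counterclockwise order) such that for every directed edge from `v i` to `v (i + 1)`, all the
remaining vertices lie strictly to the left of it.  In particular the `n` points are distinct and
no three of them are collinear, so that `P` has exactly `n` vertices. -/
def IsConvexPolygon (n : ℕ) (P : Set Plane) : Prop :=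
  3 ≤ n ∧ ∃ v : ZMod n → Plane,
    (∀ i j : ZMod n, j ≠ i → j ≠ i + 1 → 0 < cross (v (i + 1) - v i) (v j - v i)) ∧
    P = convexHull ℝ (Set.range v)

/-- `P` is symmetric about some point `c` of the plane. -/
def IsCentrallySymmetric (P : Set Plane) : Prop :=
  ∃ c : Plane, ∀ p ∈ P, Equiv.pointReflection c p ∈ P

/-- A multiset in the plane is given as a family `x : ι → Plane` (points may be repeated).
It is discrete if every bounded region contains only finitely many of its members, counted with
multiplicity. -/
def IsDiscreteMultiset {ι : Type} (x : ι → Plane) : Prop :=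
  ∀ B : Set Plane, Bornology.IsBounded B → {i | x i ∈ B}.Finite

/-- `K + X`, for the multiset `X` given by `x`, is a `k`-fold translative tiling of the plane:
`k` is positive, `X` is discrete, every point belongs to at least `k` of the translates `x i + K`,
and every point belongs to at most `k` of the translates `x i + int K` (with multiplicity). -/
structure IsFoldTiling (k : ℕ) (K : Set Plane) {ι : Type} (x : ι → Plane) : Prop where
  pos : 1 ≤ k
  discrete : IsDiscreteMultiset x
  covering : ∀ p : Plane, (k : ℕ∞) ≤ {i | p ∈ x i +ᵥ K}.encard
  packing : ∀ p : Plane, {i | p ∈ x i +ᵥ interior K}.encard ≤ (k : ℕ∞)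

/-- `K` forms a `k`-fold translative tiling of the plane. -/
def IsFoldTile (k : ℕ) (K : Set Plane) : Prop :=
  ∃ (ι : Type) (x : ι → Plane), IsFoldTiling k K x

/-- The least `k` such that `K` forms a `k`-fold translative tiling of the plane, and `∞` if there
is no such `k`. -/
noncomputable def tau (K : Set Plane) : ℕ∞ :=
  ⨅ (k : ℕ) (_ : IsFoldTile k K), (k : ℕ∞)

end MultipleTiling

/-! At a point p, let C, H and N_j count the tiles having p in their interior, inside an edge, and
as their j-th vertex. Just off p in a direction d parallel to no edge, exactly k tiles are present,
namely those whose tangent cone at p contains d (`IsFoldTiling.encard_cone`). Take d between the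
directions of the edges j - 1 and j, and add the counts for d and -d. An interior tile is counted
twice, an edge tile once, and a vertex tile once, except that the line along d misses the cones at
the vertices j and j + m. So N_j + N_{j+m} = c does not depend on j, and 2k = 2C + H + (m - 1)c
(`IsFoldTiling.two_mul_add_eq`).

Let p be a vertex 0 of some tile, so c ≥ 1. If c ≥ 2, then k ≥ m - 1. Otherwise put e = `edge v 0`
and p' = p + e, which is vertex 1 of the same tile, and assume c' = 1 there as well. Counting in two
directions on either side of e gives 2k ≤ 2C + H + 2I + N_0 + N_{m+1}, where I counts the tiles with
p on the boundary that e enters strictly (`IsFoldTiling.two_mul_le`). Hence 2I ≥ m - 3. By central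
symmetry each of these tiles has p' in its interior (`IsCCW.height_add_edge_pos`), so C' ≥ I. The
equation at p' then gives 2k ≥ 2I + (m - 1) ≥ 2m - 4. For even m, parity improves 2I ≥ m - 3 to 2I ≥
m - 2, and k ≥ m - 1 follows. -/

namespace MultipleTiling

open scoped Pointwise

/-! ### Algebra of the planar cross product. -/

section Cross

theorem cross_self (a : Plane) : cross a a = 0 := by unfold cross; ring

theorem cross_swap (a b : Plane) : cross a b = -cross b a := by unfold cross; ring

theorem cross_neg_left (a b : Plane) : cross (-a) b = -cross a b := by
  simp only [cross, PiLp.neg_apply]; ring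

theorem cross_neg_right (a b : Plane) : cross a (-b) = -cross a b := by
  simp only [cross, PiLp.neg_apply]; ring

theorem cross_add_right (a b c : Plane) : cross a (b + c) = cross a b + cross a c := by
  simp only [cross, PiLp.add_apply]; ring

theorem cross_sub_right (a b c : Plane) : cross a (b - c) = cross a b - cross a c := by
  simp only [cross, PiLp.sub_apply]; ring

theorem cross_smul_right (a : Plane) (r : ℝ) (b : Plane) : cross a (r • b) = r * cross a b := by
  simp only [cross, PiLp.smul_apply, smul_eq_mul]; ring

theorem cross_sum_smul_right {ι : Type*} [Fintype ι] (a : Plane) (w : ι → ℝ) (z : ι → Plane) :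
    cross a (∑ i, w i • z i) = ∑ i, w i * cross a (z i) := by
  simp only [cross, WithLp.ofLp_sum, Finset.sum_apply, PiLp.smul_apply, smul_eq_mul,
    Finset.mul_sum, ← Finset.sum_sub_distrib]
  exact Finset.sum_congr rfl fun i _ => by ring

theorem continuous_cross_right (a : Plane) : Continuous (cross a) := by
  unfold cross; fun_prop

/-- Two non-parallel vectors span the plane. -/
theorem cross_smul_eq (a b p : Plane) :
    cross a b • p = cross p b • a + cross a p • b := by
  ext i; fin_cases i <;> simp [cross] <;> ring

/-- The relation `0 < cross · ·` is transitive on an open half-plane. -/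
theorem cross_pos_trans {a x y z : Plane} (hx : 0 < cross a x) (hy : 0 < cross a y)
    (hz : 0 < cross a z) (hxy : 0 < cross x y) (hyz : 0 < cross y z) : 0 < cross x z := by
  have h : cross a y * cross x z = cross a x * cross y z + cross a z * cross x y := by
    unfold cross; ring
  exact pos_of_mul_pos_right (h ▸ by positivity : 0 < cross a y * cross x z) hy.le

end Cross

/-! ### Convex polygons described by signed distances from edge lines. -/

/-- `v` enumerates the vertices of a convex polygon counterclockwise. -/
def IsCCW {n : ℕ} (v : ZMod n → Plane) : Prop :=
  ∀ i j : ZMod n, j ≠ i → j ≠ i + 1 → 0 < cross (v (i + 1) - v i) (v j - v i)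

/-- The directed edge from `v t` to `v (t + 1)`. -/
def edge {n : ℕ} (v : ZMod n → Plane) (t : ZMod n) : Plane := v (t + 1) - v t

/-- The scaled signed distance of `p` from the line through the edge `t`. -/
def height {n : ℕ} (v : ZMod n → Plane) (t : ZMod n) (p : Plane) : ℝ := cross (edge v t) (p - v t)

section Polygon

variable {n : ℕ} {v : ZMod n → Plane}

theorem height_add (t : ZMod n) (p d : Plane) :
    height v t (p + d) = height v t p + cross (edge v t) d := by
  rw [height, height, ← cross_add_right]; congr 1; abel

theorem height_sub_height (t : ZMod n) (p q : Plane) :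
    height v t p - height v t q = cross (edge v t) (p - q) := by
  rw [height, height, ← cross_sub_right]; congr 1; abel

theorem continuous_height (t : ZMod n) : Continuous (height v t) :=
  (continuous_cross_right _).comp (by fun_prop)

theorem height_self (t : ZMod n) : height v t (v t) = 0 := by simp [height, cross]

theorem height_succ (t : ZMod n) : height v t (v (t + 1)) = 0 := cross_self _

theorem height_sum_smul {ι : Type*} [Fintype ι] (t : ZMod n) (w : ι → ℝ) (hw : ∑ i, w i = 1)
    (z : ι → Plane) : height v t (∑ i, w i • z i) = ∑ i, w i * height v t (z i) := by
  simp only [height, cross_sub_right, cross_sum_smul_right, mul_sub, Finset.sum_sub_distrib]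
  rw [← Finset.sum_mul, hw, one_mul]

theorem one_ne_zero_of_three_le (hn : 3 ≤ n) : (1 : ZMod n) ≠ 0 := by
  have : Fact (1 < n) := ⟨by omega⟩
  exact one_ne_zero

theorem two_ne_zero_of_three_le (hn : 3 ≤ n) : (2 : ZMod n) ≠ 0 := by
  intro h
  have := (ZMod.natCast_eq_zero_iff 2 n).1 (by exact_mod_cast h)
  exact absurd (Nat.le_of_dvd (by norm_num) this) (by omega)

theorem IsCCW.height_pos (hv : IsCCW v) {t j : ZMod n} (h : j ≠ t) (h' : j ≠ t + 1) :
    0 < height v t (v j) := hv t j h h'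

theorem IsCCW.height_nonneg (hv : IsCCW v) (t j : ZMod n) : 0 ≤ height v t (v j) := by
  by_cases h : j = t
  · rw [h, height_self]
  by_cases h' : j = t + 1
  · rw [h', height_succ]
  exact (hv.height_pos h h').le

theorem IsCCW.height_eq_zero_iff (hv : IsCCW v) {t j : ZMod n} :
    height v t (v j) = 0 ↔ j = t ∨ j = t + 1 := by
  constructor
  · intro h
    by_contra! hc
    exact (hv.height_pos hc.1 hc.2).ne' h
  · rintro (rfl | rfl)
    · exact height_self _
    · exact height_succ _

theorem IsCCW.cross_edge_succ_pos (hv : IsCCW v) (hn : 3 ≤ n) (t : ZMod n) :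
    0 < cross (edge v t) (edge v (t + 1)) := by
  have h2 : t + 1 + 1 ≠ t := fun h => two_ne_zero_of_three_le hn (by linear_combination h)
  have h1 : t + 1 + 1 ≠ t + 1 := fun h => one_ne_zero_of_three_le hn (by linear_combination h)
  have := hv.height_pos h2 h1
  have e := height_sub_height t (v (t + 1 + 1)) (v (t + 1)) (v := v)
  rw [height_succ, sub_zero] at e
  exact this.trans_eq e

theorem IsCCW.injective (hv : IsCCW v) (hn : 3 ≤ n) : Function.Injective v := by
  intro i j h
  by_contra hij
  rcases hv.height_eq_zero_iff.1 (h ▸ height_self i : height v i (v j) = 0) with h1 | h1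
  · exact hij h1.symm
  · have := hv.cross_edge_succ_pos hn i
    rw [edge, ← h1, ← h] at this
    simp [cross] at this

theorem exists_weights {p : Plane} (hp : p ∈ convexHull ℝ (Set.range v)) :
    ∃ (ι : Type) (_ : Fintype ι) (w : ι → ℝ) (f : ι → ZMod n),
      (∀ i, 0 ≤ w i) ∧ ∑ i, w i = 1 ∧ ∑ i, w i • v (f i) = p := by
  obtain ⟨ι, _, w, z, h0, h1, hz, hp⟩ := mem_convexHull_iff_exists_fintype.1 hp
  choose f hf using hz
  exact ⟨ι, _, w, f, h0, h1, by simpa only [hf] using hp⟩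

theorem IsCCW.height_nonneg_of_mem (hv : IsCCW v) {p : Plane}
    (hp : p ∈ convexHull ℝ (Set.range v)) (t : ZMod n) : 0 ≤ height v t p := by
  obtain ⟨ι, _, w, f, h0, h1, rfl⟩ := exists_weights hp
  rw [height_sum_smul t w h1]
  exact Finset.sum_nonneg fun i _ => mul_nonneg (h0 i) (hv.height_nonneg _ _)

/-- If a functional f separates p from the polygon, expand p minus the vertex maximizing f in the
two edges at that vertex. Both contributions to f are nonpositive, a contradiction. -/
theorem IsCCW.mem_convexHull_iff (hv : IsCCW v) (hn : 3 ≤ n) {p : Plane} :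
    p ∈ convexHull ℝ (Set.range v) ↔ ∀ t, 0 ≤ height v t p := by
  have : NeZero n := ⟨by omega⟩
  refine ⟨fun hp => hv.height_nonneg_of_mem hp, fun hp => ?_⟩
  by_contra hc
  obtain ⟨f, u, hf, hu⟩ := geometric_hahn_banach_closed_point (convex_convexHull ℝ (Set.range v))
    ((Set.finite_range v).isClosed_convexHull ℝ) hc
  obtain ⟨t, ht⟩ := Finite.exists_max fun t => f (v (t + 1))
  have hpos := hv.cross_edge_succ_pos hn t
  have e1 : f (edge v (t + 1)) ≤ 0 := by
    have := ht (t + 1); simp only [edge, map_sub]; linarith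
  have e2 : 0 ≤ f (edge v t) := by
    have := ht (t - 1); rw [sub_add_cancel] at this; simp only [edge, map_sub]; linarith
  have key := congrArg f (cross_smul_eq (edge v t) (edge v (t + 1)) (p - v (t + 1)))
  simp only [map_add, map_smul, smul_eq_mul] at key
  have a1 : 0 ≤ cross (edge v t) (p - v (t + 1)) := by
    rw [← height_sub_height, height_succ]; simpa using hp t
  have a2 : cross (p - v (t + 1)) (edge v (t + 1)) ≤ 0 := by
    rw [cross_swap]; exact neg_nonpos.2 (hp (t + 1))
  have a3 : 0 < f (p - v (t + 1)) := by
    have := hf _ (subset_convexHull ℝ _ ⟨t + 1, rfl⟩)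
    rw [map_sub]; linarith
  nlinarith [mul_pos hpos a3, mul_nonneg a1 (neg_nonneg.2 e1), mul_nonneg (neg_nonneg.2 a2) e2]

/-- A point of the polygon on two different edge lines is a vertex. -/
theorem IsCCW.exists_eq_vertex (hv : IsCCW v) (hn : 3 ≤ n) {p : Plane}
    (hp : p ∈ convexHull ℝ (Set.range v)) {s t : ZMod n} (hst : s ≠ t) (hs : height v s p = 0)
    (ht : height v t p = 0) : ∃ j, p = v j := by
  obtain ⟨ι, _, w, f, h0, h1, rfl⟩ := exists_weights hp
  -- A vanishing sum of nonnegative heights forces every point of positive weight onto the edge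
  -- line. Two different edges share at most one vertex, so all the weight sits on one vertex.
  have aux : ∀ r, height v r (∑ i, w i • v (f i)) = 0 → ∀ i, w i ≠ 0 → f i = r ∨ f i = r + 1 := by
    intro r hr i hi
    rw [height_sum_smul r w h1, Finset.sum_eq_zero_iff_of_nonneg
      fun i _ => mul_nonneg (h0 i) (hv.height_nonneg _ _)] at hr
    exact hv.height_eq_zero_iff.1 ((mul_eq_zero.1 (hr i (Finset.mem_univ i))).resolve_left hi)
  obtain ⟨i₀, hi₀⟩ : ∃ i, w i ≠ 0 := by
    by_contra! hc
    simp [hc] at h1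
  refine ⟨f i₀, ?_⟩
  have hall : ∀ i, w i • v (f i) = w i • v (f i₀) := by
    intro i
    by_cases hi : w i = 0
    · simp [hi]
    have : f i = f i₀ := by
      have h2 := two_ne_zero_of_three_le hn
      rcases aux s hs i hi with a | a <;> rcases aux s hs i₀ hi₀ with b | b <;>
        rcases aux t ht i hi with c | c <;> rcases aux t ht i₀ hi₀ with d | d <;>
        first
        | exact a.trans b.symm
        | exact c.trans d.symm
        | exact absurd (a.symm.trans c) hst
        | exact absurd (b.symm.trans d) hst
        | exact absurd (show (2 : ZMod n) = 0 by linear_combination a + d - b - c) h2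
        | exact absurd (show (2 : ZMod n) = 0 by linear_combination b + c - a - d) h2
    rw [this]
  rw [Finset.sum_congr rfl fun i _ => hall i, ← Finset.sum_smul, h1, one_smul]

/-- A point reflection that maps a convex polygon to itself permutes the vertices. -/
theorem IsCCW.exists_vertex_add_eq (hv : IsCCW v) (hn : 3 ≤ n) {c : Plane}
    (hc : ∀ p ∈ convexHull ℝ (Set.range v),
      Equiv.pointReflection c p ∈ convexHull ℝ (Set.range v)) (t : ZMod n) :
    ∃ j, v t + v j = (2 : ℝ) • c := by
  have hr : ∀ p, Equiv.pointReflection c p = (2 : ℝ) • c - p := by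
    intro p
    simp only [Equiv.pointReflection_apply, vsub_eq_sub, vadd_eq_add, two_smul]; abel
  simp only [hr] at hc
  have hmem : ∀ j, v j ∈ convexHull ℝ (Set.range v) := fun j => subset_convexHull ℝ _ ⟨j, rfl⟩
  obtain ⟨ι, _, w, f, h0, h1, hw⟩ := exists_weights (hc _ (hmem t))
  -- The vertex `v t` is a convex combination of reflected vertices. Being extreme, it must equal
  -- each one that carries weight.
  have hw' : ∑ i, w i • ((2 : ℝ) • c - v (f i)) = v t := by
    simp only [smul_sub, Finset.sum_sub_distrib]
    rw [← Finset.sum_smul, h1, hw, one_smul]; abel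
  obtain ⟨i₀, hi₀⟩ : ∃ i, w i ≠ 0 := by
    by_contra! hc
    simp [hc] at h1
  have aux : ∀ r, height v r (v t) = 0 → height v r ((2 : ℝ) • c - v (f i₀)) = 0 := by
    intro r hr
    rw [← hw', height_sum_smul r w h1, Finset.sum_eq_zero_iff_of_nonneg
      fun i _ => mul_nonneg (h0 i) (hv.height_nonneg_of_mem (hc _ (hmem _)) _)] at hr
    exact (mul_eq_zero.1 (hr i₀ (Finset.mem_univ _))).resolve_left hi₀
  have z1 := aux t (height_self t)
  have z2 := aux (t - 1) (by rw [hv.height_eq_zero_iff]; right; ring)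
  have hne : t - 1 ≠ t := fun h => one_ne_zero_of_three_le hn (by linear_combination -h)
  obtain ⟨j, hj⟩ := hv.exists_eq_vertex hn (hc _ (hmem _)) hne z2 z1
  rw [hj, hv.height_eq_zero_iff] at z1 z2
  have : j = t := by
    rcases z1 with h | h
    · exact h
    · rcases z2 with h' | h'
      · exact absurd (show (2 : ZMod n) = 0 by linear_combination h' - h)
          (two_ne_zero_of_three_le hn)
      · linear_combination h'
  subst this
  exact ⟨f i₀, by rw [← hj]; abel⟩

end Polygon

/-! ### Central symmetry as the index shift by `m`. -/

section Polygon

variable {n : ℕ} {v : ZMod n → Plane}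

/-- A point reflection preserves orientation. If the image of an edge were not an edge, the same
triangle would have positive area when seen from edge `t` and negative area when seen from edge `σ
t`. -/
theorem IsCCW.pointReflection_vertex_succ (hv : IsCCW v) (hn : 3 ≤ n) {q : Plane}
    {σ : ZMod n → ZMod n} (hσ : ∀ t, v t + v (σ t) = q) (t : ZMod n) : σ (t + 1) = σ t + 1 := by
  have hinj := hv.injective hn
  have h1 := one_ne_zero_of_three_le hn
  have huniq : ∀ a b, v a + v b = q → σ a = b := fun a b h =>
    hinj (add_left_cancel ((hσ a).trans h.symm))
  by_contra hne
  have hus : σ (t + 1) ≠ σ t := by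
    intro h
    have := (hσ t).trans (hσ (t + 1)).symm
    rw [h] at this
    exact h1 (by linear_combination -(hinj (add_right_cancel this)))
  have p1 := hv (σ t) (σ (t + 1)) hus hne
  have hr1 : σ (σ t + 1) ≠ t := by
    intro h
    have := huniq t (σ t + 1) (by rw [add_comm, ← hσ (σ t + 1), h])
    exact h1 (by linear_combination -this)
  have hr2 : σ (σ t + 1) ≠ t + 1 := by
    intro h
    exact hne (huniq (t + 1) (σ t + 1) (by rw [add_comm, ← hσ (σ t + 1), h]))
  have p2 := hv t (σ (σ t + 1)) hr1 hr2
  have e1 : v (σ t) = q - v t := by rw [← hσ t]; abel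
  have e2 : v (σ (t + 1)) = q - v (t + 1) := by rw [← hσ (t + 1)]; abel
  have e3 : v (σ (σ t + 1)) = q - v (σ t + 1) := by rw [← hσ (σ t + 1)]; abel
  rw [e3] at p2
  rw [e1, e2] at p1
  have : cross (v (σ t + 1) - (q - v t)) (q - v (t + 1) - (q - v t)) =
      -cross (v (t + 1) - v t) (q - v (σ t + 1) - v t) := by
    simp only [cross, PiLp.sub_apply]; ring
  linarith

theorem zmod_two_mul_eq {m : ℕ} [NeZero (2 * m)] {a : ZMod (2 * m)} (h : a + a = 0) :
    a = 0 ∨ a = m := by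
  rw [← ZMod.natCast_zmod_val a] at h ⊢
  have hlt := ZMod.val_lt a
  have hd : 2 * m ∣ a.val + a.val := (ZMod.natCast_eq_zero_iff _ _).1 (by exact_mod_cast h)
  obtain ⟨b, hb⟩ := hd
  have : b < 2 := by by_contra! hb2; nlinarith
  interval_cases b
  · left; rw [show a.val = 0 by omega]; simp
  · right; congr 1; omega

theorem IsCCW.add_antipode {m : ℕ} {v : ZMod (2 * m) → Plane} (hv : IsCCW v) (hm : 2 ≤ m)
    (hs : IsCentrallySymmetric (convexHull ℝ (Set.range v))) :
    ∃ q : Plane, ∀ t, v t + v (t + m) = q := by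
  have hn : 3 ≤ 2 * m := by omega
  have : NeZero (2 * m) := ⟨by omega⟩
  obtain ⟨c, hc⟩ := hs
  refine ⟨(2 : ℝ) • c, ?_⟩
  choose σ hσ using hv.exists_vertex_add_eq hn hc
  have hinj := hv.injective hn
  have hsucc := hv.pointReflection_vertex_succ hn hσ
  have hnat : ∀ r : ℕ, σ r = σ 0 + r := by
    intro r
    induction r with
    | zero => simp
    | succ r ih => push_cast; rw [hsucc, ih]; ring
  have hall : ∀ t, σ t = t + σ 0 := by
    intro t
    rw [← ZMod.natCast_zmod_val t, hnat, add_comm]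
  -- The reflection is an involution acting as a shift, so twice the shift vanishes. A zero shift
  -- would place every vertex at the centre.
  have h00 : σ 0 + σ 0 = 0 := by
    rw [← hall (σ 0)]
    refine hinj (add_left_cancel ((hσ (σ 0)).trans ?_))
    rw [add_comm, ← hσ 0]
  rcases zmod_two_mul_eq h00 with h0 | h0
  · exfalso
    have a0 := hσ 0
    have a1 := hσ 1
    rw [hall, h0, add_zero] at a0 a1
    have : v 0 = v 1 := by
      have := a0.trans a1.symm
      rw [← two_smul ℝ, ← two_smul ℝ] at this
      exact smul_right_injective _ (two_ne_zero (α := ℝ)) this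
    exact one_ne_zero_of_three_le hn (hinj this).symm
  · intro t
    rw [← h0, ← hall]; exact hσ t

theorem natCast_injOn {a b : ℕ} (ha : a < n) (hb : b < n) (h : (a : ZMod n) = b) : a = b := by
  rw [ZMod.natCast_eq_natCast_iff'] at h
  rwa [Nat.mod_eq_of_lt ha, Nat.mod_eq_of_lt hb] at h

/-- The vertices seen from `v i` are in counterclockwise order. -/
theorem IsCCW.cross_diagonal_pos (hv : IsCCW v) (hn : 3 ≤ n) (i : ZMod n) {r s : ℕ} (hr : 1 ≤ r)
    (hrs : r < s) (hs : s < n) : 0 < cross (v (i + r) - v i) (v (i + s) - v i) := by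
  have hcast : ∀ a b : ℕ, a < n → b < n → i + (a : ZMod n) = i + b → a = b := fun a b ha hb h =>
    natCast_injOn ha hb (add_left_cancel h)
  have hone : ∀ a : ℕ, 2 ≤ a → a < n → 0 < cross (v (i + 1) - v i) (v (i + a) - v i) := by
    intro a h2 ha
    refine hv i _ (fun h => ?_) fun h => ?_
    · have := hcast a 0 ha (by omega) (by simpa using h); omega
    · have := hcast a 1 ha (by omega) (by simpa using h); omega
  have hstep : ∀ a : ℕ, 1 ≤ a → a + 1 < n →
      0 < cross (v (i + a) - v i) (v (i + (a + 1 : ℕ)) - v i) := by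
    intro a h1 ha
    have := hv (i + a) i (fun h => by
      have := hcast 0 a (by omega) (by omega) (by simpa using h); omega) (fun h => by
      have := hcast 0 (a + 1) (by omega) (by omega) (by push_cast; linear_combination h); omega)
    push_cast
    rw [← add_assoc]
    calc _ < _ := this
      _ = _ := by simp only [cross, PiLp.sub_apply]; ring
  induction s, hrs using Nat.le_induction with
  | base => exact hstep r hr hs
  | succ s hs' ih =>
    rcases hr.eq_or_lt with rfl | hr'
    · simpa using hone (s + 1) (by omega) hs
    · exact cross_pos_trans (hone r hr' (by omega)) (hone s (by omega) (by omega))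
        (hone (s + 1) (by omega) hs) (ih (by omega)) (hstep s (by omega) hs)

end Polygon

/-! ### Edge directions of a symmetric polygon. -/

section Symmetric

variable {m : ℕ} {v : ZMod (2 * m) → Plane}

theorem edge_antipode {q : Plane} (hq : ∀ t, v t + v (t + m) = q) (t : ZMod (2 * m)) :
    edge v (t + m) = -edge v t := by
  have e1 : v (t + m) = q - v t := by rw [← hq t]; abel
  have e2 : v (t + m + 1) = q - v (t + 1) := by rw [← hq (t + 1), add_right_comm]; abel
  rw [edge, edge, e1, e2]; abel

theorem height_add_height_antipode {q : Plane} (hq : ∀ t, v t + v (t + m) = q)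
    (i j : ZMod (2 * m)) :
    height v i (v j) + height v i (v (j + m)) = height v i (v (i + m)) := by
  have e1 : v (j + m) = q - v j := by rw [← hq j]; abel
  have e2 : v (i + m) = q - v i := by rw [← hq i]; abel
  rw [e1, e2]
  simp only [height, cross, PiLp.sub_apply]; ring

/-- The edges of one half of a centrally symmetric polygon turn by less than a half-turn. -/
theorem IsCCW.cross_edge_pos (hv : IsCCW v) (hm : 2 ≤ m) {q : Plane}
    (hq : ∀ t, v t + v (t + m) = q) (i : ZMod (2 * m)) {r : ℕ} (hr : 1 ≤ r) (hrm : r < m) :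
    0 < cross (edge v i) (edge v (i + r)) := by
  have hcast : ∀ a b : ℕ, a < 2 * m → b < 2 * m → i + (a : ZMod (2 * m)) = i + b → a = b :=
    fun a b ha hb h => natCast_injOn ha hb (add_left_cancel h)
  rcases hr.eq_or_lt with rfl | hr1
  · simpa using hv.cross_edge_succ_pos (by omega) i
  have hdiff : height v i (v (i + r + 1)) - height v i (v (i + r)) =
      cross (edge v i) (edge v (i + r)) := height_sub_height _ _ _
  have hjpos : 0 < height v i (v (i + r)) := hv.height_pos
    (fun h => by have := hcast r 0 (by omega) (by omega) (by simpa using h); omega)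
    (fun h => by have := hcast r 1 (by omega) (by omega) (by simpa using h); omega)
  have hjtop : height v i (v (i + r)) < height v i (v (i + m)) := by
    have : 0 < height v i (v (i + r + m)) := hv.height_pos
      (fun h => by
        have := hcast (r + m) 0 (by omega) (by omega) (by push_cast; linear_combination h); omega)
      (fun h => by
        have := hcast (r + m) 1 (by omega) (by omega) (by push_cast; linear_combination h); omega)
    linarith [height_add_height_antipode hq i (i + r)]
  -- Here `v (i + m)` ends the edge `i + r`, so `A1` below would fail. Being the highest vertex over
  -- edge `i`, it settles the sign directly.
  by_cases hrm1 : r + 1 = m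
  · rw [← hdiff, add_assoc, show (r : ZMod (2 * m)) + 1 = m by rw [← hrm1]; push_cast; rfl]
    linarith
  by_contra! hle
  have A1 : 0 < height v (i + r) (v (i + m)) := hv.height_pos
    (fun h => by have := hcast m r (by omega) (by omega) h; omega)
    (fun h => by
      have := hcast m (r + 1) (by omega) (by omega) (by push_cast; linear_combination h); omega)
  have B1 : 0 < height v (i + r) (v i) := hv.height_pos
    (fun h => by have := hcast 0 r (by omega) (by omega) (by simpa using h); omega)
    (fun h => by
      have := hcast 0 (r + 1) (by omega) (by omega) (by push_cast; linear_combination h); omega)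
  have AB : 0 < cross (v (i + m) - v (i + r)) (v i - v (i + r)) := by
    have := hv.cross_diagonal_pos (by omega) i hr hrm (by omega)
    calc _ < _ := this
      _ = _ := by simp only [cross, PiLp.sub_apply]; ring
  have yA : 0 < cross (edge v i) (v (i + m) - v (i + r)) := by
    rw [← height_sub_height]; linarith
  have yB : cross (edge v i) (v i - v (i + r)) < 0 := by
    rw [← height_sub_height, height_self]; linarith
  -- Plücker relation: the signs of the other five cross products determine that of `cross y e`.
  have key : ∀ y e A B : Plane, cross y e * cross A B - cross y A * cross e B
      + cross y B * cross e A = 0 := by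
    intro y e A B; unfold cross; ring
  have := key (edge v i) (edge v (i + r)) (v (i + m) - v (i + r)) (v i - v (i + r))
  unfold height at A1 B1
  nlinarith [mul_pos yA B1, mul_pos (neg_pos.2 yB) A1, mul_nonneg (neg_nonneg.2 hle) AB.le]

/-- A direction strictly between those of the edges `j - 1` and `j`. -/
def midDir {n : ℕ} (v : ZMod n → Plane) (j : ZMod n) : Plane := edge v (j - 1) + edge v j

theorem IsCCW.cross_midDir_neg (hv : IsCCW v) (hm : 2 ≤ m) {q : Plane}
    (hq : ∀ t, v t + v (t + m) = q) (j : ZMod (2 * m)) {r : ℕ} (hr : r < m) :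
    cross (edge v (j + r)) (midDir v j) < 0 := by
  rw [midDir, cross_add_right, cross_swap, cross_swap (edge v (j + r)) (edge v j)]
  have a1 : r + 1 < m → 0 < cross (edge v (j - 1)) (edge v (j + r)) := fun h => by
    have := hv.cross_edge_pos hm hq (j - 1) (r := r + 1) (by omega) h
    rwa [show j - 1 + ((r + 1 : ℕ) : ZMod (2 * m)) = j + r by push_cast; ring] at this
  rcases Nat.eq_zero_or_pos r with rfl | hr0
  · have := a1 (by omega)
    simp only [Nat.cast_zero, add_zero, cross_self] at *
    linarith
  · have a2 := hv.cross_edge_pos hm hq j hr0 hr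
    by_cases h : r + 1 < m
    · linarith [a1 h]
    · have : j + (r : ZMod (2 * m)) = j - 1 + m := by
        have e : ((r + 1 : ℕ) : ZMod (2 * m)) = (m : ℕ) := congrArg Nat.cast (by omega)
        push_cast at e
        linear_combination e
      rw [this] at a2 ⊢
      rw [edge_antipode hq] at a2 ⊢
      rw [cross_neg_right (edge v (j - 1)), cross_self]
      linarith

/-- This turns the question whether `midDir v j` points inward across edge `t` into arithmetic on
indices modulo `2 * m`. -/
theorem IsCCW.cross_midDir_pos_iff (hv : IsCCW v) (hm : 2 ≤ m) {q : Plane}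
    (hq : ∀ t, v t + v (t + m) = q) (j t : ZMod (2 * m)) :
    0 < cross (edge v t) (midDir v j) ↔ m ≤ (t - j).val := by
  have : NeZero (2 * m) := ⟨by omega⟩
  have ht : t = j + ((t - j).val : ZMod (2 * m)) := by simp
  have hlt := ZMod.val_lt (t - j)
  generalize (t - j).val = r at ht hlt
  subst ht
  rcases lt_or_ge r m with h | h
  · simp only [h.not_ge, iff_false, not_lt]
    exact (hv.cross_midDir_neg hm hq j h).le
  · simp only [h, iff_true]
    obtain ⟨s, rfl⟩ := Nat.exists_eq_add_of_le h
    have := hv.cross_midDir_neg hm hq j (r := s) (by omega)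
    rw [show j + ((m + s : ℕ) : ZMod (2 * m)) = j + s + m by push_cast; ring, edge_antipode hq,
      cross_neg_left]
    linarith

theorem IsCCW.cross_midDir_ne_zero (hv : IsCCW v) (hm : 2 ≤ m) {q : Plane}
    (hq : ∀ t, v t + v (t + m) = q) (j t : ZMod (2 * m)) :
    cross (edge v t) (midDir v j) ≠ 0 := by
  have : NeZero (2 * m) := ⟨by omega⟩
  rcases lt_or_ge (t - j).val m with h | h
  · have := hv.cross_midDir_neg hm hq j h
    simp only [ZMod.natCast_zmod_val, add_sub_cancel] at this
    exact this.ne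
  · exact ((hv.cross_midDir_pos_iff hm hq j t).2 h).ne'

/-- If `edge v 0` points into the polygon at the boundary point `p`, then `p + edge v 0` is an
interior point. -/
theorem IsCCW.height_add_edge_pos (hv : IsCCW v) (hm : 3 ≤ m) {q : Plane}
    (hq : ∀ t, v t + v (t + m) = q) {p : Plane} (hp : ∀ t, 0 ≤ height v t p) {s : ZMod (2 * m)}
    (hs : height v s p = 0) (hin : ∀ t, height v t p = 0 → 0 < cross (edge v t) (edge v 0))
    (t : ZMod (2 * m)) : 0 < height v t (p + edge v 0) := by
  have hcast : ∀ a b : ℕ, a < 2 * m → b < 2 * m → (a : ZMod (2 * m)) = b → a = b :=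
    fun a b ha hb h => natCast_injOn ha hb h
  have hem : edge v m = -edge v 0 := by simpa using edge_antipode hq 0
  have h0 : 0 < height v 0 p := lt_of_le_of_ne (hp 0) fun h =>
    (hin 0 h.symm).ne' (cross_self _)
  have hm0 : 0 < height v m p := lt_of_le_of_ne (hp m) fun h => by
    have := hin m h.symm
    rw [hem, cross_neg_left, cross_self] at this
    simp at this
  have htop : height v 0 (v m) - height v 0 p = height v m p := by
    rw [height_sub_height, height, hem, cross_neg_left, ← cross_neg_right]; congr 1; abel
  have hvm1 : v (m + 1) = v m - edge v 0 := by
    rw [← sub_add_cancel (v (m + 1)) (v m), show v (m + 1) - v m = edge v m from rfl, hem]; abel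
  have hv1 : v 1 = v 0 + edge v 0 := by simp [edge]
  set T := height v 0 (v m) with hT
  have hTpos : 0 < T := by linarith
  set l := height v 0 p / T with hl
  have hl0 : 0 < l := div_pos h0 hTpos
  have hl1 : l < 1 := by rw [hl, div_lt_one hTpos]; linarith
  have hlT : l * T = height v 0 p := div_mul_cancel₀ _ hTpos.ne'
  have hcomb : ∀ t (a b : Plane),
      height v t (a + l • (b - a)) = (1 - l) * height v t a + l * height v t b := by
    intro t a b
    rw [height_add, cross_smul_right, ← height_sub_height]; ring
  set x := v 0 + l • (v (m + 1) - v 0) with hx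
  have hxq : x + edge v 0 = v 1 + l • (v m - v 1) := by rw [hx, hvm1, hv1]; module
  obtain ⟨a, ha⟩ : ∃ a : ℝ, p = x + a • edge v 0 := by
    have hb := hv.cross_edge_succ_pos (by omega) 0
    have h1 : cross (edge v 0) (p - x) = 0 := by
      have : height v 0 (v (m + 1)) = T := by
        rw [hvm1, sub_eq_add_neg, height_add, cross_neg_right, cross_self]; ring
      rw [← height_sub_height, hx, hcomb, height_self, this]; linarith
    have h2 := cross_smul_eq (edge v 0) (edge v (0 + 1)) (p - x)
    rw [h1, zero_smul, add_zero] at h2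
    refine ⟨(cross (edge v 0) (edge v (0 + 1)))⁻¹ * cross (p - x) (edge v (0 + 1)), ?_⟩
    rw [mul_smul, ← h2, smul_smul, inv_mul_cancel₀ hb.ne', one_smul]; abel
  have hpx : ∀ t, height v t p = height v t x + a * cross (edge v t) (edge v 0) := by
    intro t; rw [ha, height_add, cross_smul_right]
  -- A zero height would put both v_0 and v_{m+1} on edge `s`, but for m ≥ 3 they are not adjacent.
  have hxs : 0 < height v s x := by
    have n0 := hv.height_nonneg s 0
    have n1 := hv.height_nonneg s (m + 1)
    rw [hx, hcomb]
    rcases n0.eq_or_lt with z0 | z0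
    · rcases n1.eq_or_lt with z1 | z1
      · exfalso
        rcases hv.height_eq_zero_iff.1 z0.symm with y0 | y0 <;>
          rcases hv.height_eq_zero_iff.1 z1.symm with y1 | y1
        · have := hcast (m + 1) 0 (by omega) (by omega) (by push_cast; rw [y1, y0])
          omega
        · have := hcast m 0 (by omega) (by omega) (by
            push_cast; linear_combination y1 - y0)
          omega
        · have := hcast (m + 2) 0 (by omega) (by omega) (by
            push_cast; linear_combination y1 - y0)
          omega
        · have := hcast (m + 1) 0 (by omega) (by omega) (by push_cast; rw [y1, y0])
          omega
      · have := mul_pos hl0 z1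
        have := mul_nonneg (sub_nonneg.2 hl1.le) n0
        linarith
    · have := mul_pos (sub_pos.2 hl1) z0
      have := mul_nonneg hl0.le n1
      linarith
  -- So `p` precedes `x` along `edge v 0`, and `p + edge v 0` lies strictly between `p` and the
  -- polygon point `x + edge v 0`.
  have ha0 : a < 0 := by
    have h1 := hpx s
    have h2 := hin s hs
    by_contra! h
    nlinarith [mul_nonneg h h2.le]
  have hq0 : 0 ≤ height v t x + cross (edge v t) (edge v 0) := by
    rw [← height_add, hxq, hcomb]
    have := mul_nonneg hl0.le (hv.height_nonneg t m)
    have := mul_nonneg (sub_nonneg.2 hl1.le) (hv.height_nonneg t 1)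
    linarith
  rw [height_add]
  by_contra! hle
  rcases (hp t).eq_or_lt with h | h
  · have := hin t h.symm
    linarith
  · have := hpx t
    nlinarith [mul_nonneg (neg_nonneg.2 ha0.le) (neg_nonneg.2 hle), mul_pos (neg_pos.2 ha0) h]

end Symmetric

/-! ### Counting tiles just off a point in a generic direction. -/

section LocalCount

variable {n : ℕ} {v : ZMod n → Plane} {k : ℕ} {ι : Type} {x : ι → Plane}

theorem IsCCW.mem_interior (hv : IsCCW v) (hn : 3 ≤ n) {p : Plane} (hp : ∀ t, 0 < height v t p) :
    p ∈ interior (convexHull ℝ (Set.range v)) := by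
  have : NeZero n := ⟨by omega⟩
  refine interior_maximal (s := convexHull ℝ (Set.range v)) (t := {p | ∀ t, 0 < height v t p})
    (fun y hy => (hv.mem_convexHull_iff hn).2 fun t => (hy t).le) ?_ hp
  rw [Set.ofPred_forall]
  exact isOpen_iInter_of_finite fun t => isOpen_lt continuous_const (continuous_height t)

theorem mem_vadd_set_iff_sub_mem {K : Set Plane} {a p : Plane} : p ∈ a +ᵥ K ↔ p - a ∈ K := by
  rw [Set.mem_vadd_set_iff_neg_vadd_mem, vadd_eq_add, neg_add_eq_sub]

theorem IsDiscreteMultiset.finite_sub_mem (h : IsDiscreteMultiset x) {K : Set Plane}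
    (hK : Bornology.IsBounded K) (p : Plane) (r : ℝ) :
    {i | ∃ d : Plane, ‖d‖ ≤ r ∧ p + d - x i ∈ K}.Finite := by
  obtain ⟨R, hR⟩ := hK.exists_norm_le
  refine (h (Metric.closedBall p (R + r)) Metric.isBounded_closedBall).subset ?_
  rintro i ⟨d, hd, hi⟩
  have h1 := hR _ hi
  rw [Set.mem_ofPred_eq, Metric.mem_closedBall, dist_comm, dist_eq_norm]
  calc ‖p - x i‖ = ‖(p + d - x i) - d‖ := by congr 1; abel
    _ ≤ ‖p + d - x i‖ + ‖d‖ := norm_sub_le _ _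
    _ ≤ R + r := add_le_add h1 hd

/-- The tiles at `p` whose tangent cone at `p` contains the generic direction `d` are exactly
`k` in number. -/
theorem IsFoldTiling.encard_cone (h : IsFoldTiling k (convexHull ℝ (Set.range v)) x)
    (hv : IsCCW v) (hn : 3 ≤ n) (p : Plane) {d : Plane} (hd : ∀ t, cross (edge v t) d ≠ 0) :
    {i | p - x i ∈ convexHull ℝ (Set.range v) ∧
      ∀ t, height v t (p - x i) = 0 → 0 < cross (edge v t) d}.encard = k := by
  have : NeZero n := ⟨by omega⟩
  have hb : Bornology.IsBounded (convexHull ℝ (Set.range v)) :=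
    isBounded_convexHull.2 (Set.finite_range v).isBounded
  have hfin := h.discrete.finite_sub_mem hb p ‖d‖
  -- Discreteness leaves finitely many tiles near `p`, so one small ε preserves all strict signs at
  -- once. Only zero heights can change sign, and they do so according to `d`.
  have hev : ∀ᶠ ε : ℝ in nhdsWithin 0 (Set.Ioi 0),
      ∀ i ∈ {i | ∃ d' : Plane, ‖d'‖ ≤ ‖d‖ ∧ p + d' - x i ∈ convexHull ℝ (Set.range v)}, ∀ t,
        (0 < height v t (p - x i) → 0 < height v t (p - x i + ε • d)) ∧
        (height v t (p - x i) < 0 → height v t (p - x i + ε • d) < 0) := by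
    rw [Filter.eventually_all_finite hfin]
    intro i _
    rw [Filter.eventually_all]
    intro t
    have hc : Filter.Tendsto (fun ε : ℝ => height v t (p - x i + ε • d))
        (nhdsWithin 0 (Set.Ioi 0)) (nhds (height v t (p - x i))) := by
      have : Continuous fun ε : ℝ => height v t (p - x i + ε • d) :=
        (continuous_height t).comp (by fun_prop)
      have := this.tendsto 0
      rw [zero_smul, add_zero] at this
      exact this.mono_left nhdsWithin_le_nhds
    rw [Filter.eventually_and]
    constructor
    · by_cases h0 : 0 < height v t (p - x i)
      · exact (hc.eventually_const_lt h0).mono fun _ h _ => h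
      · exact Filter.Eventually.of_forall fun _ h => absurd h h0
    · by_cases h0 : height v t (p - x i) < 0
      · exact (hc.eventually_lt_const h0).mono fun _ h _ => h
      · exact Filter.Eventually.of_forall fun _ h => absurd h h0
  obtain ⟨ε, hε, hε0, hε1⟩ := (hev.and (Ioo_mem_nhdsGT (zero_lt_one' ℝ))).exists
  have heq : ∀ i, p + ε • d - x i = p - x i + ε • d := fun i => by abel
  have hstrict : ∀ i, p - x i ∈ convexHull ℝ (Set.range v) ∧
      (∀ t, height v t (p - x i) = 0 → 0 < cross (edge v t) d) →
      ∀ t, 0 < height v t (p - x i + ε • d) := by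
    rintro i ⟨hi, hi'⟩ t
    rcases (hv.height_nonneg_of_mem hi t).eq_or_lt with h0 | h0
    · rw [height_add, ← h0, cross_smul_right, zero_add]
      exact mul_pos hε0 (hi' t h0.symm)
    · exact (hε i ⟨0, by simp, by simpa using hi⟩ t).1 h0
  have hmem : ∀ i, p - x i + ε • d ∈ convexHull ℝ (Set.range v) →
      p - x i ∈ convexHull ℝ (Set.range v) ∧
      (∀ t, height v t (p - x i) = 0 → 0 < cross (edge v t) d) := by
    intro i hi
    have hI := hε i ⟨ε • d, by
      rw [norm_smul, Real.norm_of_nonneg hε0.le]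
      exact mul_le_of_le_one_left (norm_nonneg _) hε1.le, by rwa [heq]⟩
    have hh := (hv.mem_convexHull_iff hn).1 hi
    refine ⟨(hv.mem_convexHull_iff hn).2 fun t => ?_, fun t ht => ?_⟩
    · by_contra! hc
      exact absurd (hh t) (not_le.2 ((hI t).2 hc))
    · have := hh t
      rw [height_add, ht, cross_smul_right, zero_add] at this
      exact lt_of_le_of_ne (nonneg_of_mul_nonneg_right this hε0) (hd t).symm
  -- At `p + ε • d` no tile boundary is met, so the packing and covering bounds apply to the same
  -- set of tiles.
  apply le_antisymm
  · refine (Set.encard_le_encard fun i hi => ?_).trans (h.packing (p + ε • d))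
    rw [Set.mem_ofPred_eq, mem_vadd_set_iff_sub_mem, heq]
    exact hv.mem_interior hn (hstrict i hi)
  · refine (h.covering (p + ε • d)).trans (Set.encard_le_encard fun i hi => ?_)
    rw [Set.mem_ofPred_eq, mem_vadd_set_iff_sub_mem, heq] at hi
    exact hmem i hi

end LocalCount

/-! ### Classification of a point's position within one tile. -/

section Indicators

variable {n : ℕ}

open Classical in
/-- Whether the tangent cone of the polygon at `w` contains the direction `d` in its interior. -/
noncomputable def coneInd (v : ZMod n → Plane) (d w : Plane) : ℕ :=
  if ∀ t, height v t w = 0 → 0 < cross (edge v t) d then 1 else 0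

open Classical in
/-- Whether `w` lies on no edge line. -/
noncomputable def interiorInd (v : ZMod n → Plane) (w : Plane) : ℕ :=
  if ∀ t, height v t w ≠ 0 then 1 else 0

open Classical in
/-- Whether `w` is the vertex `v j`. -/
noncomputable def vertexInd (v : ZMod n → Plane) (j : ZMod n) (w : Plane) : ℕ :=
  if w = v j then 1 else 0

open Classical in
/-- Whether `w` lies on an edge line and is not a vertex. -/
noncomputable def edgeInd (v : ZMod n → Plane) (w : Plane) : ℕ :=
  if (∃ t, height v t w = 0) ∧ ∀ j, w ≠ v j then 1 else 0

open Classical in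
/-- Whether `w` lies on an edge line and the direction `edge v 0` points inward there. -/
noncomputable def inwardInd (v : ZMod n → Plane) (w : Plane) : ℕ :=
  if (∃ t, height v t w = 0) ∧ ∀ t, height v t w = 0 → 0 < cross (edge v t) (edge v 0) then 1
  else 0

theorem zmod_val_sub_one {m : ℕ} (hm : 2 ≤ m) (a : ZMod (2 * m)) :
    (a = 0 ∧ a.val = 0 ∧ (a - 1).val = 2 * m - 1) ∨
      (a ≠ 0 ∧ 0 < a.val ∧ (a - 1).val = a.val - 1) := by
  have : NeZero (2 * m) := ⟨by omega⟩
  by_cases h : a = 0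
  · refine Or.inl ⟨h, by simp [h], ?_⟩
    have e : a - 1 = ((2 * m - 1 : ℕ) : ZMod (2 * m)) := by
      rw [Nat.cast_sub (by omega), ZMod.natCast_self, h]; simp
    rw [e, ZMod.val_natCast_of_lt (by omega)]
  · have hpos : 0 < a.val := Nat.pos_of_ne_zero fun h0 => h ((ZMod.val_eq_zero a).1 h0)
    refine Or.inr ⟨h, hpos, ?_⟩
    have e : a - 1 = ((a.val - 1 : ℕ) : ZMod (2 * m)) := by
      rw [Nat.cast_sub (by omega), ZMod.natCast_zmod_val]; simp
    rw [e, ZMod.val_natCast_of_lt (by have := ZMod.val_lt a; omega)]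

theorem zmod_eq_half_iff {m : ℕ} (hm : 2 ≤ m) (a : ZMod (2 * m)) : a = m ↔ a.val = m := by
  have : NeZero (2 * m) := ⟨by omega⟩
  constructor
  · rintro rfl
    exact ZMod.val_natCast_of_lt (by omega)
  · intro h
    rw [← ZMod.natCast_zmod_val a, h]

variable {v : ZMod n → Plane}

/-- The points of a polygon lie in the interior, at a vertex, or on exactly one edge. -/
theorem IsCCW.point_cases (hv : IsCCW v) (hn : 3 ≤ n) {w : Plane}
    (hw : w ∈ convexHull ℝ (Set.range v)) :
    (∀ t, height v t w ≠ 0) ∨ (∃ j, w = v j) ∨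
      ((∀ j, w ≠ v j) ∧ ∃ s, ∀ t, height v t w = 0 ↔ t = s) := by
  by_cases h1 : ∀ t, height v t w ≠ 0
  · exact Or.inl h1
  by_cases h2 : ∃ j, w = v j
  · exact Or.inr (Or.inl h2)
  push Not at h1 h2
  obtain ⟨s, hs⟩ := h1
  refine Or.inr (Or.inr ⟨h2, s, fun t => ⟨fun ht => ?_, fun ht => ht ▸ hs⟩⟩)
  by_contra hts
  obtain ⟨j, hj⟩ := hv.exists_eq_vertex hn hw hts ht hs
  exact h2 j hj

theorem IsCCW.vertexInd_eq_zero {w : Plane} (h : ∀ t, height v t w ≠ 0) (j : ZMod n) :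
    vertexInd v j w = 0 := by
  rw [vertexInd, if_neg]
  rintro rfl
  exact h j (height_self j)

open Classical in
theorem IsCCW.vertexInd_vertex (hv : IsCCW v) (hn : 3 ≤ n) (j t : ZMod n) :
    vertexInd v j (v t) = if t = j then 1 else 0 := by
  simp only [vertexInd, (hv.injective hn).eq_iff]

open Classical in
theorem IsCCW.coneInd_vertex (hv : IsCCW v) (d : Plane) (t : ZMod n) :
    coneInd v d (v t) = if 0 < cross (edge v t) d ∧ 0 < cross (edge v (t - 1)) d then 1 else 0 := by
  rw [coneInd]
  congr 1
  simp only [hv.height_eq_zero_iff, eq_iff_iff]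
  constructor
  · exact fun h => ⟨h t (Or.inl rfl), h (t - 1) (Or.inr (by ring))⟩
  · rintro ⟨h1, h2⟩ s (rfl | rfl)
    · exact h1
    · simpa using h2

theorem interiorInd_vertex (t : ZMod n) : interiorInd v (v t) = 0 :=
  if_neg fun h => h t (height_self t)

theorem edgeInd_vertex (t : ZMod n) : edgeInd v (v t) = 0 := if_neg fun h => h.2 t rfl

end Indicators

/-! ### Contribution of a single tile to the two direction counts. -/

section Symmetric

variable {m : ℕ} {v : ZMod (2 * m) → Plane}

theorem IsCCW.cross_neg_midDir_pos_iff (hv : IsCCW v) (hm : 2 ≤ m) {q : Plane}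
    (hq : ∀ t, v t + v (t + m) = q) (j t : ZMod (2 * m)) :
    0 < cross (edge v t) (-midDir v j) ↔ (t - j).val < m := by
  rw [← not_le (a := m), ← hv.cross_midDir_pos_iff hm hq j t, cross_neg_right, neg_pos, not_lt,
    le_iff_lt_or_eq, or_iff_left (hv.cross_midDir_ne_zero hm hq j t)]

/-- A line through `w` not parallel to an edge: the number of its two directions that enter the
polygon. -/
theorem IsCCW.coneInd_add_coneInd_neg [NeZero (2 * m)] (hv : IsCCW v) (hm : 2 ≤ m) {q : Plane}
    (hq : ∀ t, v t + v (t + m) = q) {w : Plane} (hw : w ∈ convexHull ℝ (Set.range v))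
    (j : ZMod (2 * m)) :
    coneInd v (midDir v j) w + coneInd v (-midDir v j) w + vertexInd v j w
        + vertexInd v (j + m) w =
      2 * interiorInd v w + edgeInd v w + ∑ t, vertexInd v t w := by
  rcases hv.point_cases (by omega) hw with h | ⟨t, rfl⟩ | ⟨h, s, hs⟩
  · have hc : ∀ d, coneInd v d w = 1 := fun d => if_pos fun t ht => absurd ht (h t)
    have hi : interiorInd v w = 1 := if_pos h
    have he : edgeInd v w = 0 := if_neg fun ⟨⟨t, ht⟩, _⟩ => h t ht
    simp only [IsCCW.vertexInd_eq_zero h, hc, hi, he, Finset.sum_const_zero]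
  · simp only [hv.vertexInd_vertex (by omega), hv.coneInd_vertex, interiorInd_vertex,
      edgeInd_vertex, hv.cross_midDir_pos_iff hm hq, hv.cross_neg_midDir_pos_iff hm hq,
      Finset.sum_ite_eq, Finset.mem_univ, if_true]
    have e1 : t = j ↔ (t - j).val = 0 := by rw [ZMod.val_eq_zero, sub_eq_zero]
    have e2 : t = j + m ↔ (t - j).val = m := by
      rw [← zmod_eq_half_iff hm, sub_eq_iff_eq_add, add_comm]
    have e3 : t - 1 - j = t - j - 1 := by ring
    rw [e3]
    simp only [e1, e2]
    have hlt := ZMod.val_lt (t - j)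
    have hval := zmod_val_sub_one hm (t - j)
    generalize (t - j).val = r at *
    generalize (t - j - 1).val = r' at *
    split_ifs <;> omega
  · have hi : interiorInd v w = 0 := if_neg fun h' => h' s ((hs s).2 rfl)
    have he : edgeInd v w = 1 := if_pos ⟨⟨s, (hs s).2 rfl⟩, h⟩
    have hvert : ∀ j, vertexInd v j w = 0 := fun j => if_neg (h j)
    simp only [hi, he, hvert, coneInd, hs, forall_eq, hv.cross_midDir_pos_iff hm hq,
      hv.cross_neg_midDir_pos_iff hm hq, Finset.sum_const_zero]
    split_ifs <;> omega

/-- A half-plane containing `midDir v 0` and `midDir v 1` also contains `edge v 0`, whose direction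
lies between them. -/
theorem IsCCW.cross_edge_pos_of_midDir (hv : IsCCW v) (hm : 2 ≤ m) {q : Plane}
    (hq : ∀ t, v t + v (t + m) = q) {t : ZMod (2 * m)} (h : m ≤ t.val) (h' : m ≤ (t - 1).val) :
    0 < cross (edge v t) (edge v 0) := by
  have : NeZero (2 * m) := ⟨by omega⟩
  have hlt := ZMod.val_lt t
  rcases zmod_val_sub_one hm t with ⟨h1, h2, h3⟩ | ⟨h1, h2, h3⟩
  · omega
  · have := hv.cross_edge_pos hm hq 0 (r := t.val - m) (by omega) (by omega)
    have e : t = 0 + ((t.val - m : ℕ) : ZMod (2 * m)) + m := by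
      rw [Nat.cast_sub h, ZMod.natCast_zmod_val]; ring
    rw [e, edge_antipode hq, cross_neg_left, ← cross_swap]
    exact this

/-- The tangent cones that contain directions on both sides of `edge v 0`. -/
theorem IsCCW.coneInd_add_coneInd_succ_le (hv : IsCCW v) (hm : 2 ≤ m) {q : Plane}
    (hq : ∀ t, v t + v (t + m) = q) {w : Plane} (hw : w ∈ convexHull ℝ (Set.range v)) :
    coneInd v (midDir v 0) w + coneInd v (midDir v 1) w ≤
      2 * interiorInd v w + 2 * inwardInd v w + vertexInd v 0 w + vertexInd v (m + 1) w
        + edgeInd v w := by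
  have : NeZero (2 * m) := ⟨by omega⟩
  have hle : ∀ d, coneInd v d w ≤ 1 := fun d => by unfold coneInd; split_ifs <;> simp
  by_cases hint : ∀ t, height v t w ≠ 0
  · have : interiorInd v w = 1 := if_pos hint
    linarith [hle (midDir v 0), hle (midDir v 1)]
  have hex : ∃ t, height v t w = 0 := by simpa using hint
  by_cases hboth : ∀ t, height v t w = 0 → m ≤ (t - 0).val ∧ m ≤ (t - 1).val
  · have : inwardInd v w = 1 := if_pos ⟨hex, fun t ht => by
      have := hboth t ht
      rw [sub_zero] at this
      exact hv.cross_edge_pos_of_midDir hm hq this.1 this.2⟩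
    linarith [hle (midDir v 0), hle (midDir v 1)]
  have hone : coneInd v (midDir v 0) w + coneInd v (midDir v 1) w ≤ 1 := by
    by_contra! hc
    have h0 : coneInd v (midDir v 0) w ≠ 0 := by have := hle (midDir v 1); omega
    have h1 : coneInd v (midDir v 1) w ≠ 0 := by have := hle (midDir v 0); omega
    simp only [coneInd, hv.cross_midDir_pos_iff hm hq, ne_eq, ite_eq_right_iff, one_ne_zero,
      imp_false, not_not] at h0 h1
    exact hboth fun t ht => ⟨h0 t ht, h1 t ht⟩
  rcases hv.point_cases (by omega) hw with h | ⟨t, rfl⟩ | ⟨h, s, hs⟩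
  · exact absurd h hint
  -- The vertices 0 and m + 1 are those whose tangent cone has a side along `edge v 0`; such a cone
  -- contains just one of the two directions.
  · simp only [hv.vertexInd_vertex (by omega), hv.coneInd_vertex,
      hv.cross_midDir_pos_iff hm hq, sub_zero] at hone ⊢
    have e2 : t = m + 1 ↔ (t - 1).val = m := by
      rw [← zmod_eq_half_iff hm, sub_eq_iff_eq_add]
    have e1 : t = 0 ↔ t.val = 0 := (ZMod.val_eq_zero t).symm
    simp only [e1, e2]
    have hlt := ZMod.val_lt t
    rcases zmod_val_sub_one hm t with ⟨h1, h2, h3⟩ | ⟨h1, h2, h3⟩ <;>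
    rcases zmod_val_sub_one hm (t - 1) with ⟨h1', h2', h3'⟩ | ⟨h1', h2', h3'⟩ <;>
    · simp only [h2, h3, h3'] at hone ⊢
      split_ifs at hone ⊢ <;> omega
  · have : edgeInd v w = 1 := if_pos ⟨hex, h⟩
    omega

end Symmetric

/-! ### Summation over the tiles at a point and the final estimate. -/

section Count

variable {m k : ℕ} {v : ZMod (2 * m) → Plane} {ι : Type} {x : ι → Plane}

theorem IsFoldTiling.exists_tilesAt (h : IsFoldTiling k (convexHull ℝ (Set.range v)) x)
    (hm : 2 ≤ m) (p : Plane) :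
    ∃ F : Finset ι, ∀ i, i ∈ F ↔ p - x i ∈ convexHull ℝ (Set.range v) := by
  have : NeZero (2 * m) := ⟨by omega⟩
  have hb : Bornology.IsBounded (convexHull ℝ (Set.range v)) :=
    isBounded_convexHull.2 (Set.finite_range v).isBounded
  have hfin : {i | p - x i ∈ convexHull ℝ (Set.range v)}.Finite :=
    (h.discrete.finite_sub_mem hb p 0).subset fun i hi => ⟨0, by simp, by simpa using hi⟩
  exact ⟨hfin.toFinset, fun i => by simp⟩

theorem IsFoldTiling.sum_coneInd (h : IsFoldTiling k (convexHull ℝ (Set.range v)) x)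
    (hv : IsCCW v) (hm : 2 ≤ m) {p d : Plane} (hd : ∀ t, cross (edge v t) d ≠ 0) {F : Finset ι}
    (hF : ∀ i, i ∈ F ↔ p - x i ∈ convexHull ℝ (Set.range v)) :
    ∑ i ∈ F, coneInd v d (p - x i) = k := by
  classical
  have h1 := h.encard_cone hv (by omega) p hd
  have h2 : {i | p - x i ∈ convexHull ℝ (Set.range v) ∧
      ∀ t, height v t (p - x i) = 0 → 0 < cross (edge v t) d} =
      (F.filter fun i => ∀ t, height v t (p - x i) = 0 → 0 < cross (edge v t) d : Finset ι) := by
    ext i; simp [hF]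
  rw [h2, Set.encard_coe_eq_coe_finsetCard, Nat.cast_inj] at h1
  rw [← h1, Finset.card_filter]
  rfl

/-- The angle count at a point: the tiles with a vertex there come in complete families. -/
theorem IsFoldTiling.two_mul_add_eq (h : IsFoldTiling k (convexHull ℝ (Set.range v)) x)
    (hv : IsCCW v) (hm : 2 ≤ m) {q : Plane} (hq : ∀ t, v t + v (t + m) = q) {p : Plane}
    {F : Finset ι} (hF : ∀ i, i ∈ F ↔ p - x i ∈ convexHull ℝ (Set.range v)) :
    ∃ c : ℕ, (∀ j, ∑ i ∈ F, vertexInd v j (p - x i) ≤ c) ∧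
      2 * k + c = 2 * ∑ i ∈ F, interiorInd v (p - x i) + ∑ i ∈ F, edgeInd v (p - x i) + m * c := by
  have : NeZero (2 * m) := ⟨by omega⟩
  set N : ZMod (2 * m) → ℕ := fun j => ∑ i ∈ F, vertexInd v j (p - x i) with hN
  set C := ∑ i ∈ F, interiorInd v (p - x i)
  set H := ∑ i ∈ F, edgeInd v (p - x i)
  have key : ∀ j, 2 * k + N j + N (j + m) = 2 * C + H + ∑ t, N t := by
    intro j
    have h1 := h.sum_coneInd hv hm (hv.cross_midDir_ne_zero hm hq j) hF
    have h2 := h.sum_coneInd hv hm (d := -midDir v j) (p := p) (fun t => by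
      rw [cross_neg_right, neg_ne_zero]; exact hv.cross_midDir_ne_zero hm hq j t) hF
    have h3 := Finset.sum_congr (rfl : F = F) fun i hi =>
      hv.coneInd_add_coneInd_neg hm hq ((hF i).1 hi) j
    simp only [Finset.sum_add_distrib, ← Finset.mul_sum, h1, h2] at h3
    rw [Finset.sum_comm] at h3
    simp only [hN]
    rw [two_mul]
    exact h3
  have hconst : ∀ j, N j + N (j + m) = N 0 + N (0 + m) := fun j => by
    have := key j; have := key 0; omega
  -- Summing `N j + N (j + m)` over all `2 * m` indices counts each vertex class twice.
  have hsum : ∑ t, N t = m * (N 0 + N (0 + m)) := by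
    have h1 : ∑ j, (N j + N (j + m)) = 2 * m * (N 0 + N (0 + m)) := by
      rw [Finset.sum_congr rfl fun j _ => hconst j, Finset.sum_const, Finset.card_univ, ZMod.card,
        smul_eq_mul]
    rw [Finset.sum_add_distrib, show ∑ j, N (j + m) = ∑ j, N j from
      Equiv.sum_comp (Equiv.addRight (m : ZMod (2 * m))) N] at h1
    nlinarith
  refine ⟨N 0 + N (0 + m), fun j => ?_, ?_⟩
  · rw [← hconst j]; exact Nat.le_add_right _ _
  · rw [← hsum, ← key 0, add_assoc]

theorem IsFoldTiling.two_mul_le (h : IsFoldTiling k (convexHull ℝ (Set.range v)) x)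
    (hv : IsCCW v) (hm : 2 ≤ m) {q : Plane} (hq : ∀ t, v t + v (t + m) = q) {p : Plane}
    {F : Finset ι} (hF : ∀ i, i ∈ F ↔ p - x i ∈ convexHull ℝ (Set.range v)) :
    2 * k ≤ 2 * ∑ i ∈ F, interiorInd v (p - x i) + 2 * ∑ i ∈ F, inwardInd v (p - x i)
      + ∑ i ∈ F, vertexInd v 0 (p - x i) + ∑ i ∈ F, vertexInd v (m + 1) (p - x i)
      + ∑ i ∈ F, edgeInd v (p - x i) := by
  have h3 := Finset.sum_le_sum fun i hi =>
    hv.coneInd_add_coneInd_succ_le hm hq ((hF i).1 hi)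
  simp only [Finset.sum_add_distrib, ← Finset.mul_sum,
    h.sum_coneInd hv hm (hv.cross_midDir_ne_zero hm hq 0) hF,
    h.sum_coneInd hv hm (hv.cross_midDir_ne_zero hm hq 1) hF] at h3
  linarith

/-- Tiles entered at `p` by `edge v 0` contain the other endpoint of that edge in their
interior. -/
theorem IsCCW.sum_inwardInd_le (hv : IsCCW v) (hm : 3 ≤ m) {q : Plane}
    (hq : ∀ t, v t + v (t + m) = q) {p : Plane} {F F' : Finset ι}
    (hF : ∀ i, i ∈ F ↔ p - x i ∈ convexHull ℝ (Set.range v))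
    (hF' : ∀ i, i ∈ F' ↔ p + edge v 0 - x i ∈ convexHull ℝ (Set.range v)) :
    ∑ i ∈ F, inwardInd v (p - x i) ≤ ∑ i ∈ F', interiorInd v (p + edge v 0 - x i) := by
  classical
  simp only [inwardInd, interiorInd, ← Finset.card_filter]
  refine Finset.card_le_card fun i hi => ?_
  rw [Finset.mem_filter, hF] at hi
  obtain ⟨hi, ⟨s, hs⟩, hin⟩ := hi
  have hpos := hv.height_add_edge_pos hm hq (hv.height_nonneg_of_mem hi) hs hin
  rw [sub_add_eq_add_sub] at hpos
  rw [Finset.mem_filter, hF', hv.mem_convexHull_iff (by omega)]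
  exact ⟨fun t => (hpos t).le, fun t => (hpos t).ne'⟩

theorem IsFoldTiling.le_of_symmetric_polygon
    (h : IsFoldTiling k (convexHull ℝ (Set.range v)) x) (hv : IsCCW v) (hm : 3 ≤ m) {q : Plane}
    (hq : ∀ t, v t + v (t + m) = q) : m - 2 ≤ k ∧ (Even m → m - 1 ≤ k) := by
  have hm2 : 2 ≤ m := by omega
  -- Covering with `k ≥ 1` needs at least one tile.
  obtain ⟨i₀⟩ : Nonempty ι := by
    by_contra hne
    rw [not_nonempty_iff] at hne
    have := h.covering 0
    rw [Set.eq_empty_of_isEmpty {i | _}, Set.encard_empty] at this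
    have := h.pos
    simp_all
  set p := x i₀ + v 0 with hp
  obtain ⟨F, hF⟩ := h.exists_tilesAt hm2 p
  obtain ⟨F', hF'⟩ := h.exists_tilesAt hm2 (p + edge v 0)
  obtain ⟨c, hc, e⟩ := h.two_mul_add_eq hv hm2 hq hF
  obtain ⟨c', hc', e'⟩ := h.two_mul_add_eq hv hm2 hq hF'
  have hmem : ∀ j, v j ∈ convexHull ℝ (Set.range v) := fun j => subset_convexHull ℝ _ ⟨j, rfl⟩
  have hpos : ∀ (p : Plane) (F : Finset ι) (j : ZMod (2 * m)), p - x i₀ = v j → i₀ ∈ F →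
      1 ≤ ∑ i ∈ F, vertexInd v j (p - x i) := by
    intro p F j hj hi
    calc 1 = vertexInd v j (p - x i₀) := (if_pos hj).symm
      _ ≤ _ := Finset.single_le_sum (f := fun i => vertexInd v j (p - x i))
        (fun _ _ => Nat.zero_le _) hi
  have p0 : p - x i₀ = v 0 := by rw [hp]; abel
  have p1 : p + edge v 0 - x i₀ = v 1 := by rw [hp, edge, zero_add]; abel
  have hc1 := (hpos p F 0 p0 ((hF i₀).2 (p0 ▸ hmem 0))).trans (hc 0)
  have hc1' := (hpos _ F' 1 p1 ((hF' i₀).2 (p1 ▸ hmem 1))).trans (hc' 1)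
  have hlarge : ∀ {c a : ℕ}, 2 ≤ c → 2 * k + c = a + m * c → m - 1 ≤ k := by
    intro c a h2 he
    obtain ⟨b, rfl⟩ := Nat.exists_eq_add_of_le hm
    obtain ⟨b', rfl⟩ := Nat.exists_eq_add_of_le h2
    have : 2 * k = a + 2 * (2 + b) + (2 + b) * b' := by nlinarith
    have := Nat.zero_le ((2 + b) * b')
    omega
  by_cases h2 : 2 ≤ c
  · have := hlarge h2 e
    exact ⟨by omega, fun _ => this⟩
  by_cases h2' : 2 ≤ c'
  · have := hlarge h2' e'
    exact ⟨by omega, fun _ => this⟩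
  obtain rfl : c = 1 := by omega
  obtain rfl : c' = 1 := by omega
  -- With c = c' = 1, both vertex counts in `hle` are at most 1. Combined with `e`, `hin` and `e'`,
  -- this leaves linear arithmetic, in which the parity of `m` matters.
  have hle := h.two_mul_le hv hm2 hq hF
  have hin := hv.sum_inwardInd_le hm hq hF hF'
  have v0 := hc 0
  have v1 := hc (m + 1)
  refine ⟨by omega, ?_⟩
  rintro ⟨b, rfl⟩
  omega

end Count

theorem le_tau_of_forall {K : Set Plane} {a : ℕ} (h : ∀ k, IsFoldTile k K → a ≤ k) :
    (a : ℕ∞) ≤ tau K :=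
  le_iInf₂ fun k hk => by exact_mod_cast h k hk

end MultipleTiling

theorem theorem1 (m : ℕ) (hm : 2 ≤ m) (P : Set MultipleTiling.Plane)
    (hP : MultipleTiling.IsConvexPolygon (2 * m) P)
    (hsymm : MultipleTiling.IsCentrallySymmetric P) :
    (Even m → ((m - 1 : ℕ) : ℕ∞) ≤ MultipleTiling.tau P) ∧
    (Odd m → ((m - 2 : ℕ) : ℕ∞) ≤ MultipleTiling.tau P) := by
  obtain ⟨-, v, hv, rfl⟩ := hP
  have hv : MultipleTiling.IsCCW v := hv
  obtain ⟨q, hq⟩ := hv.add_antipode hm hsymm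
  -- For m = 2 the bounds are 1 and 0, and `k ≥ 1` suffices; the geometric argument needs m ≥ 3.
  rcases hm.eq_or_lt with rfl | hm3
  · exact ⟨fun _ => MultipleTiling.le_tau_of_forall fun k ⟨_, _, h⟩ => h.pos,
      fun _ => MultipleTiling.le_tau_of_forall fun k _ => Nat.zero_le k⟩
  · exact ⟨fun he => MultipleTiling.le_tau_of_forall fun k ⟨_, _, h⟩ =>
        (h.le_of_symmetric_polygon hv hm3 hq).2 he,
      fun _ => MultipleTiling.le_tau_of_forall fun k ⟨_, _, h⟩ =>
        (h.le_of_symmetric_polygon hv hm3 hq).1⟩
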